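/- Let $\mathcal E$ be a real separable Banach space and let $M$ be a connected, separable, metrizable $C^\infty$ Banach manifold modelled on $\mathcal E$. Let $\Delta=\{\delta(n)\}_{n=1}^\infty$ be a strictly increasing sequence of natural numbers. \textbf{Definitions.} A \emph{$\Delta$-flag} in a Banach space $\mathcal E'$ is a sequence of closed subspaces $E_n\subseteq\mathcal E'$ with $\dim E_n=\delta(n)$, $E_n\subset E_{n+1}$, $\bigcup_n E_n$ dense in $\mathcal E'$, and such that there are closed complements $E^{\infty-n}$ of $E_n$ in $\mathcal E'$ with $E^{\infty-n}\supseteq E^{\infty-(n+1)}$ for all $n$. A \emph{$\Delta$-filtration} of $M$ is a sequence $\mathcal F=\{M_n\}_{n=1}^\infty$ of nonempty finite-dimensional closed (embedded) submanifolds of $M$ such that for all $n\ge 1$: (a) $\dim M_n=\delta(n)$; (b) $M_n\subset M_{n+1}$; (c) if $M_\infty=\bigcup_n M_n$ carries the inductive limit topology, the inclusion $M_\infty\hookrightarrow M$ is a homotopy equivalence. It is \emph{normal} if moreover (d) for every $n$ the embeddings $M_n\hookrightarrow M_{n+1}$ and $M_n\hookrightarrow M$ have (smoothly) trivial normal bundles;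 (e) there are open tubular neighborhoods $V_n$ of $M_n$ in $M$ and open sets $U_n\subseteq V_n$ with $U_n\subseteq U_{n+1}$ and $M=\bigcup_n U_n$. (An open tubular neighborhood of $M_n$ is an open set $V_n\subseteq M$ that is the image of an open neighborhood of the zero section of a smooth vector bundle over $M_n$ under a diffeomorphism which restricts to the inclusion of $M_n$ on the zero section.) It is \emph{dense} if $M_\infty$ is dense in $M$, and \emph{Fredholm} if there are a Banach space $\mathcal E'$, a $\Delta$-flag $\{E_n\}$ of $\mathcal E'$ and a smooth map $f:M\to\mathcal E'$, all of whose differentials are Fredholm operators of index zero, such that for every $n$ the map $f$ is transverse to $E_n$ (that is, whenever $f(x)\in E_n$, one has $\operatorname{im} Df_x+E_n=\mathcal E'$ and $Df_x^{-1}(E_n)$ is complemented in $T_xM$) and $M_n=f^{-1}(E_n)$. \textbf{Lemma.} Let $\mathcal F=\{M_n\}_{n=1}^\infty$ be a normal $\Delta$-filtration of $M$, let $n_1<n_2<\cdots$ be a strictly increasing sequence of indices, and put $\tilde{\mathcal F}=\{M_{n_k}\}_{k=1}^\infty$ and $\tilde\Delta=\{\delta(n_k)\}_{k=1}^\infty$.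 Then $\tilde{\mathcal F}$ is a normal $\tilde\Delta$-filtration of $M$. If $\mathcal F$ is dense, then so is $\tilde{\mathcal F}$. If $\mathcal F$ is Fredholm (as a $\Delta$-filtration), then $\tilde{\mathcal F}$ is Fredholm (as a $\tilde\Delta$-filtration). -/

import Mathlib

open Set Topology Manifold Bundle
open scoped ContDiff

universe u v w

noncomputable section

/-! ### Closed submanifolds -/

/-- A closed (embedded, boundaryless) submanifold of finite dimension `dim` of a manifold `M`
modelled on `E`: a closed subset together with a smooth manifold structure, modelled on
`ℝ ^ dim` and inducing the subspace topology, for which the inclusion is a smooth embedding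
(in suitable charts it is the inclusion of a complemented subspace). -/
structure ClosedSubmanifold (E : Type u) [NormedAddCommGroup E] [NormedSpace ℝ E]
    (M : Type v) [TopologicalSpace M] [ChartedSpace E M] where
  carrier : Set M
  isClosed_carrier : IsClosed carrier
  dim : ℕ
  chartedSpace : ChartedSpace (EuclideanSpace ℝ (Fin dim)) carrier
  isManifold : IsManifold 𝓘(ℝ, EuclideanSpace ℝ (Fin dim)) ∞ carrier
  isSmoothEmbedding :
    IsSmoothEmbedding 𝓘(ℝ, EuclideanSpace ℝ (Fin dim)) 𝓘(ℝ, E) ∞ (Subtype.val : carrier → M)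

namespace ClosedSubmanifold

variable {E : Type u} [NormedAddCommGroup E] [NormedSpace ℝ E]
  {M : Type v} [TopologicalSpace M] [ChartedSpace E M]

/-- The model space `ℝ ^ dim` of a closed submanifold. -/
abbrev Model (S : ClosedSubmanifold E M) : Type := EuclideanSpace ℝ (Fin S.dim)

instance (S : ClosedSubmanifold E M) : ChartedSpace S.Model S.carrier := S.chartedSpace

instance (S : ClosedSubmanifold E M) : IsManifold 𝓘(ℝ, S.Model) ∞ S.carrier := S.isManifold

/-- The inclusion `S ↪ M`, as a smooth map. -/
def incl (S : ClosedSubmanifold E M) : C^∞⟮𝓘(ℝ, S.Model), S.carrier; 𝓘(ℝ, E), M⟯ :=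
  ⟨Subtype.val, S.isSmoothEmbedding.contMDiff⟩

/-- The inclusion `S ↪ T` of submanifolds `S ⊆ T` of `M`, as a smooth map. -/
def inclOfSubset {S T : ClosedSubmanifold E M} (h : S.carrier ⊆ T.carrier) :
    C^∞⟮𝓘(ℝ, S.Model), S.carrier; 𝓘(ℝ, T.Model), T.carrier⟯ :=
  ⟨Set.inclusion h, (ContMDiff.iff_comp_isImmersion T.isSmoothEmbedding.isImmersion).2
    ⟨continuous_inclusion h, S.isSmoothEmbedding.contMDiff⟩⟩

end ClosedSubmanifold

/-! ### Normal bundles -/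

section NormalBundle

variable {E₁ : Type w} [NormedAddCommGroup E₁] [NormedSpace ℝ E₁]
  {N₁ : Type*} [TopologicalSpace N₁] [ChartedSpace E₁ N₁]
  {E₂ : Type u} [NormedAddCommGroup E₂] [NormedSpace ℝ E₂]
  {N₂ : Type*} [TopologicalSpace N₂] [ChartedSpace E₂ N₂] [IsManifold 𝓘(ℝ, E₂) ∞ N₂]

/-- The tangential directions `df_x (T_x N₁) ⊆ T_{f x} N₂`. -/
abbrev tangentialRange (f : C^∞⟮𝓘(ℝ, E₁), N₁; 𝓘(ℝ, E₂), N₂⟯) (x : N₁) :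
    Submodule ℝ (TangentSpace 𝓘(ℝ, E₂) (f x)) :=
  LinearMap.range (mfderiv 𝓘(ℝ, E₁) 𝓘(ℝ, E₂) f x).toLinearMap

/-- The fibre `T_{f x} N₂ / df_x (T_x N₁)` at `x` of the normal bundle of `f`, with its quotient
topology. -/
abbrev NormalFibre (f : C^∞⟮𝓘(ℝ, E₁), N₁; 𝓘(ℝ, E₂), N₂⟯) (x : N₁) : Type u :=
  TangentSpace 𝓘(ℝ, E₂) (f x) ⧸ tangentialRange f x

/-- The quotient map `f^* T N₂ → ν(f)`, on the fibre of a point of the pullback bundle. -/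
def toNormalFibre (f : C^∞⟮𝓘(ℝ, E₁), N₁; 𝓘(ℝ, E₂), N₂⟯)
    (p : TotalSpace E₂ ((f : N₁ → N₂) *ᵖ (TangentSpace 𝓘(ℝ, E₂) : N₂ → Type u))) :
    NormalFibre f p.proj :=
  (tangentialRange f p.proj).mkQ p.snd

/-- The embedding `f` has trivial normal bundle: there is a global smooth trivialization
`ν(f) ≅ N₁ × F` for some Banach space `F`, i.e. a family of topological linear isomorphisms
`τ x : ν(f)_x ≃ F` that is smooth on `ν(f)`. The smooth structure of the quotient bundle `ν(f)`
is the one for which `f^* T N₂ → ν(f)` is a surjective submersion, so smoothness on `ν(f)` means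
smoothness after composition with this map. (The inverse `N₁ × F → ν(f)` is then smooth as well,
since inversion of bounded operators is smooth.) -/
def HasTrivialNormalBundle (f : C^∞⟮𝓘(ℝ, E₁), N₁; 𝓘(ℝ, E₂), N₂⟯) : Prop :=
  ∃ (F : Type u) (_ : NormedAddCommGroup F) (_ : NormedSpace ℝ F) (_ : CompleteSpace F)
    (τ : ∀ x : N₁, NormalFibre f x ≃L[ℝ] F),
    ContMDiff (𝓘(ℝ, E₁).prod 𝓘(ℝ, E₂)) 𝓘(ℝ, F) ∞
      (fun p : TotalSpace E₂ ((f : N₁ → N₂) *ᵖ (TangentSpace 𝓘(ℝ, E₂) : N₂ → Type u)) =>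
        τ p.proj (toNormalFibre f p))

end NormalBundle

/-! ### Tubular neighborhoods -/

/-- `V` is an open tubular neighborhood of `S` in `M`: there are a smooth vector bundle `B → S`,
an open neighborhood `Z` of its zero section and a diffeomorphism `Φ` of `Z` onto the open set `V`
which is the inclusion `S ↪ M` on the zero section. -/
def IsTubularNeighborhood {E : Type u} [NormedAddCommGroup E] [NormedSpace ℝ E]
    {M : Type v} [TopologicalSpace M] [ChartedSpace E M]
    (S : ClosedSubmanifold E M) (V : Set M) : Prop :=
  ∃ (F : Type u) (_ : NormedAddCommGroup F) (_ : NormedSpace ℝ F) (_ : CompleteSpace F)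
    (B : S.carrier → Type u)
    (_ : ∀ x, AddCommGroup (B x)) (_ : ∀ x, Module ℝ (B x)) (_ : ∀ x, TopologicalSpace (B x))
    (_ : TopologicalSpace (TotalSpace F B)) (_ : FiberBundle F B) (_ : VectorBundle ℝ F B)
    (_ : ContMDiffVectorBundle ∞ F B 𝓘(ℝ, S.Model))
    (Φ : OpenPartialHomeomorph (TotalSpace F B) M),
    Φ.target = V ∧
    ContMDiffOn (𝓘(ℝ, S.Model).prod 𝓘(ℝ, F)) 𝓘(ℝ, E) ∞ Φ Φ.source ∧
    ContMDiffOn 𝓘(ℝ, E) (𝓘(ℝ, S.Model).prod 𝓘(ℝ, F)) ∞ Φ.symm V ∧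
    ∀ x : S.carrier, (⟨x, 0⟩ : TotalSpace F B) ∈ Φ.source ∧ Φ ⟨x, 0⟩ = x

/-! ### Inductive limits -/

/-- The union `⋃ n, A n` of a sequence of subspaces. -/
def InductiveLimit {M : Type v} (A : ℕ → Set M) : Type v := {x : M // ∃ n, x ∈ A n}

namespace InductiveLimit

variable {M : Type v}

/-- The inclusion `A n ↪ ⋃ k, A k`. -/
def ofMem (A : ℕ → Set M) (n : ℕ) (x : A n) : InductiveLimit A := ⟨x, n, x.2⟩

/-- The inclusion `⋃ n, A n ↪ M`. -/
def val (A : ℕ → Set M) (x : InductiveLimit A) : M := x.1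

/-- The inductive limit topology: the finest topology for which all the inclusions
`A n ↪ ⋃ k, A k` are continuous. -/
instance [TopologicalSpace M] (A : ℕ → Set M) : TopologicalSpace (InductiveLimit A) :=
  ⨆ n, TopologicalSpace.coinduced (ofMem A n) inferInstance

end InductiveLimit

/-- A map is a homotopy equivalence. -/
def IsHomotopyEquivalence {X Y : Type*} [TopologicalSpace X] [TopologicalSpace Y]
    (f : X → Y) : Prop :=
  ∃ e : ContinuousMap.HomotopyEquiv X Y, (e.toFun : X → Y) = f

/-! ### Flags, Fredholm maps and transversality -/

/-- A `Δ`-flag `A` in a Banach space, `Δ = δ`. -/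
structure IsFlag {E : Type u} [NormedAddCommGroup E] [NormedSpace ℝ E]
    (δ : ℕ → ℕ) (A : ℕ → Submodule ℝ E) : Prop where
  strictMono : StrictMono δ
  isClosed : ∀ n, IsClosed (A n : Set E)
  finiteDimensional : ∀ n, FiniteDimensional ℝ (A n)
  finrank_eq : ∀ n, Module.finrank ℝ (A n) = δ n
  le_succ : ∀ n, A n ≤ A (n + 1)
  dense : Dense (⋃ n, (A n : Set E))
  exists_complements : ∃ C : ℕ → Submodule ℝ E,
    (∀ n, IsClosed (C n : Set E) ∧ IsCompl (A n) (C n)) ∧ ∀ n, C (n + 1) ≤ C n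

section Fredholm

variable {E : Type u} [NormedAddCommGroup E] [NormedSpace ℝ E]
  {M : Type v} [TopologicalSpace M] [ChartedSpace E M]
  {E' : Type w} [NormedAddCommGroup E'] [NormedSpace ℝ E']

/-- A smooth map `f : M → E'` is a Fredholm map of index zero: each differential is a Fredholm
operator whose kernel and cokernel have equal dimension. -/
def IsFredholmMapOfIndexZero (f : M → E') : Prop :=
  ContMDiff 𝓘(ℝ, E) 𝓘(ℝ, E') ∞ f ∧
  ∀ x : M, (mfderiv 𝓘(ℝ, E) 𝓘(ℝ, E') f x).IsFredholm ∧
    Module.finrank ℝ (LinearMap.ker (mfderiv 𝓘(ℝ, E) 𝓘(ℝ, E') f x).toLinearMap) =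
    Module.finrank ℝ (TangentSpace 𝓘(ℝ, E') (f x) ⧸
      LinearMap.range (mfderiv 𝓘(ℝ, E) 𝓘(ℝ, E') f x).toLinearMap)

/-- `f : M → E'` is transverse to the linear subspace `W` of `E'`: wherever `f x ∈ W`, the range
of `df_x` and `W` span `E'` and the preimage of `W` under `df_x` is complemented. (The tangent
space of `E'` at a point is `E'`, and that of `W` is `W`.) -/
def IsTransverseTo (f : M → E') (W : Submodule ℝ E') : Prop :=
  ∀ x : M, f x ∈ W →
    LinearMap.range (mfderiv 𝓘(ℝ, E) 𝓘(ℝ, E') f x).toLinearMap ⊔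
      (show Submodule ℝ (TangentSpace 𝓘(ℝ, E') (f x)) from W) = ⊤ ∧
    (Submodule.comap (mfderiv 𝓘(ℝ, E) 𝓘(ℝ, E') f x).toLinearMap
      (show Submodule ℝ (TangentSpace 𝓘(ℝ, E') (f x)) from W)).ClosedComplemented

end Fredholm

/-! ### Generalized filtrations -/

section Filtration

variable {E : Type u} [NormedAddCommGroup E] [NormedSpace ℝ E]
  {M : Type v} [TopologicalSpace M] [ChartedSpace E M]

/-- `ℱ` is a `Δ`-filtration of `M`, `Δ = δ`. The submanifolds are nonempty (the empty set has no
dimension in `ℕ`). -/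
structure IsDeltaFiltration (δ : ℕ → ℕ) (ℱ : ℕ → ClosedSubmanifold E M) : Prop where
  strictMono : StrictMono δ
  nonempty : ∀ n, (ℱ n).carrier.Nonempty
  dim_eq : ∀ n, (ℱ n).dim = δ n
  subset_succ : ∀ n, (ℱ n).carrier ⊆ (ℱ (n + 1)).carrier
  isHomotopyEquivalence :
    IsHomotopyEquivalence (InductiveLimit.val fun n => (ℱ n).carrier)

/-- `ℱ` is a normal `Δ`-filtration of `M`, `Δ = δ`. -/
structure IsNormalFiltration [IsManifold 𝓘(ℝ, E) ∞ M] (δ : ℕ → ℕ)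
    (ℱ : ℕ → ClosedSubmanifold E M) : Prop extends IsDeltaFiltration δ ℱ where
  trivial_succ : ∀ n,
    HasTrivialNormalBundle (ClosedSubmanifold.inclOfSubset (subset_succ n))
  trivial_ambient : ∀ n, HasTrivialNormalBundle (ℱ n).incl
  exists_tubular : ∃ V U : ℕ → Set M,
    (∀ n, IsTubularNeighborhood (ℱ n) (V n)) ∧ (∀ n, IsOpen (U n)) ∧ (∀ n, U n ⊆ V n) ∧
    (∀ n, U n ⊆ U (n + 1)) ∧ ⋃ n, U n = univ

/-- A filtration is dense if the union of its members is dense in `M`. -/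
def IsDenseFiltration (ℱ : ℕ → ClosedSubmanifold E M) : Prop :=
  Dense (⋃ n, (ℱ n).carrier)

/-- A `Δ`-filtration `ℱ` is Fredholm if `ℱ n = f ⁻¹ (A n)` for a Fredholm map `f` of index zero
from `M` to some Banach space `E'` and a `Δ`-flag `A` of `E'` to which `f` is transverse. -/
def IsFredholmFiltration (δ : ℕ → ℕ) (ℱ : ℕ → ClosedSubmanifold E M) : Prop :=
  ∃ (E' : Type u) (_ : NormedAddCommGroup E') (_ : NormedSpace ℝ E') (_ : CompleteSpace E')
    (f : M → E') (A : ℕ → Submodule ℝ E'),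
    IsFredholmMapOfIndexZero (E := E) f ∧ IsFlag δ A ∧
    ∀ n, IsTransverseTo (E := E) f (A n) ∧ (ℱ n).carrier = f ⁻¹' (A n)

end Filtration

end

/-!
Only condition (d) is affected by skipping indices in an essential way: the trivial normal bundles
of `M_n ↪ M_{n+1}` must be assembled into one of `M_m ↪ M_n` for all `m < n`. If the normal bundles
of `f : N₁ → N₂` and `g : N₂ → N₃` are trivial and `g` has a smooth left inverse `r` near its image,
then `dr` splits the sequence `0 → ν(f) → ν(g ∘ f) → f^* ν(g) → 0`, so `ν(g ∘ f)` is trivial. For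
`g : M_n ↪ M_{n+1}` such an `r` is the projection of a tubular neighborhood of `M_n` in `M`,
restricted to `M_{n+1}`.
-/

open Filter

section Quotient

variable {R : Type*} [Ring R]
  {Y : Type*} [AddCommGroup Y] [Module R Y] [TopologicalSpace Y]
  {Z : Type*} [AddCommGroup Z] [Module R Z] [TopologicalSpace Z] [IsTopologicalAddGroup Z]

/-- The splitting `Z / b(A) ≃ Y / A × Z / b(Y)` induced by a continuous linear left inverse `p` of
`b : Y → Z`. The submodule `b(A)` is only required to be equal to some `C`, so that no transport is
needed when it arises in another form. -/
def quotientMapEquivProd (A : Submodule R Y) (b : Y →L[R] Z) {p : Z →L[R] Y}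
    (hp : Function.LeftInverse p b) {C : Submodule R Z} (hC : A.map b.toLinearMap = C) :
    (Z ⧸ C) ≃L[R] (Y ⧸ A) × (Z ⧸ LinearMap.range b.toLinearMap) :=
  ContinuousLinearEquiv.equivOfInverse
    (C.liftQL ((A.mkQL ∘L p).prod (Submodule.mkQL _)) (by
      subst hC
      rintro _ ⟨y, hy, rfl⟩
      simpa [hp y] using hy))
    ((A.liftQL (C.mkQL ∘L b) (by
      subst hC
      intro y hy
      simpa using ⟨y, hy, rfl⟩)).coprod
    (Submodule.liftQL _ (C.mkQL ∘L (.id R Z - b ∘L p)) (by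
      rintro _ ⟨y, rfl⟩
      simp [hp y])))
    (by
      intro z
      obtain ⟨z, rfl⟩ := Submodule.mkQ_surjective _ z
      simp)
    (by
      rintro ⟨y, z⟩
      obtain ⟨y, rfl⟩ := Submodule.mkQ_surjective _ y
      obtain ⟨z, rfl⟩ := Submodule.mkQ_surjective _ z
      have hb (y : Y) : (Submodule.Quotient.mk (b y) : Z ⧸ LinearMap.range b.toLinearMap) = 0 :=
        (Submodule.Quotient.mk_eq_zero _).2 ⟨y, rfl⟩
      simp [hp _, hb])

end Quotient

section Pullback

variable {𝕜 : Type*} [NontriviallyNormedField 𝕜]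
  {EB : Type*} [NormedAddCommGroup EB] [NormedSpace 𝕜 EB]
  {HB : Type*} [TopologicalSpace HB] {IB : ModelWithCorners 𝕜 EB HB}
  {B : Type*} [TopologicalSpace B] [ChartedSpace HB B]
  {EB' : Type*} [NormedAddCommGroup EB'] [NormedSpace 𝕜 EB']
  {HB' : Type*} [TopologicalSpace HB'] {IB' : ModelWithCorners 𝕜 EB' HB'}
  {B' : Type*} [TopologicalSpace B'] [ChartedSpace HB' B']
  {EN : Type*} [NormedAddCommGroup EN] [NormedSpace 𝕜 EN]
  {HN : Type*} [TopologicalSpace HN] {J : ModelWithCorners 𝕜 EN HN}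
  {N : Type*} [TopologicalSpace N] [ChartedSpace HN N]
  {F : Type*} [NormedAddCommGroup F] [NormedSpace 𝕜 F]
  {A : B → Type*} [∀ x, Zero (A x)]
  [∀ x, TopologicalSpace (A x)] [TopologicalSpace (TotalSpace F A)] [FiberBundle F A]
  {n : WithTop ℕ∞}

theorem contMDiff_pullback_iff (f : C^n⟮IB', B'; IB, B⟯)
    {G : N → TotalSpace F ((f : B' → B) *ᵖ A)} :
    ContMDiff J (IB'.prod 𝓘(𝕜, F)) n G ↔
      ContMDiff J IB' n (fun x => (G x).proj) ∧
        ContMDiff J (IB.prod 𝓘(𝕜, F)) n fun x => Pullback.lift f (G x) := by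
  simp only [ContMDiff, contMDiffAt_totalSpace, ← forall_and]
  exact forall_congr' fun x =>
    ⟨fun h => ⟨h.1, f.contMDiff.contMDiffAt.comp x h.1, h.2⟩, fun h => ⟨h.1, h.2.2⟩⟩

theorem contMDiff_pullbackLift (f : C^n⟮IB', B'; IB, B⟯) :
    ContMDiff (IB'.prod 𝓘(𝕜, F)) (IB.prod 𝓘(𝕜, F)) n (Pullback.lift (F := F) (E := A) f) :=
  ((contMDiff_pullback_iff f).1 contMDiff_id).2

/-- The bundle map `(g ∘ f)^* A → g^* A` over `f` that is the identity on fibres. -/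
def pullbackCompLift (g : C^n⟮IB', B'; IB, B⟯) (f : C^n⟮J, N; IB', B'⟯)
    (q : TotalSpace F ((g.comp f : N → B) *ᵖ A)) : TotalSpace F ((g : B' → B) *ᵖ A) :=
  ⟨f q.proj, q.snd⟩

theorem contMDiff_pullbackCompLift (g : C^n⟮IB', B'; IB, B⟯) (f : C^n⟮J, N; IB', B'⟯) :
    ContMDiff (J.prod 𝓘(𝕜, F)) (IB'.prod 𝓘(𝕜, F)) n (pullbackCompLift (F := F) (A := A) g f) :=
  (contMDiff_pullback_iff g).2
    ⟨f.contMDiff.comp (contMDiff_proj _), contMDiff_pullbackLift (g.comp f)⟩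

end Pullback

section NeighborhoodRetraction

variable {E₂ : Type*} [NormedAddCommGroup E₂] [NormedSpace ℝ E₂]
  {N₂ : Type*} [TopologicalSpace N₂] [ChartedSpace E₂ N₂]
  {E₃ : Type*} [NormedAddCommGroup E₃] [NormedSpace ℝ E₃]
  {N₃ : Type*} [TopologicalSpace N₃] [ChartedSpace E₃ N₃]

/-- `r` is a smooth retraction of the open set `W` onto the image of `g`, in the form of a left
inverse of `g`. It is a total function, with arbitrary values outside `W`. -/
structure IsNeighborhoodRetraction (g : C^∞⟮𝓘(ℝ, E₂), N₂; 𝓘(ℝ, E₃), N₃⟯) (r : N₃ → N₂)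
    (W : Set N₃) : Prop where
  isOpen : IsOpen W
  contMDiffOn : ContMDiffOn 𝓘(ℝ, E₃) 𝓘(ℝ, E₂) ∞ r W
  apply_mem (y : N₂) : g y ∈ W
  leftInverse : Function.LeftInverse r g

/-- The differential at `g y` of a left inverse `r` of `g`, with values in `T_y N₂` instead of
`T_{r (g y)} N₂`. (Both tangent spaces are the model space `E₂`, definitionally.) -/
noncomputable def retractionDeriv (g : C^∞⟮𝓘(ℝ, E₂), N₂; 𝓘(ℝ, E₃), N₃⟯) (r : N₃ → N₂) (y : N₂) :
    TangentSpace 𝓘(ℝ, E₃) (g y) →L[ℝ] TangentSpace 𝓘(ℝ, E₂) y :=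
  mfderiv 𝓘(ℝ, E₃) 𝓘(ℝ, E₂) r (g y)

namespace IsNeighborhoodRetraction

variable {g : C^∞⟮𝓘(ℝ, E₂), N₂; 𝓘(ℝ, E₃), N₃⟯} {r : N₃ → N₂} {W : Set N₃}

theorem leftInverse_retractionDeriv (hr : IsNeighborhoodRetraction g r W) (y : N₂) :
    Function.LeftInverse (retractionDeriv g r y) (mfderiv 𝓘(ℝ, E₂) 𝓘(ℝ, E₃) g y) := by
  intro v
  have hg : MDifferentiableAt 𝓘(ℝ, E₂) 𝓘(ℝ, E₃) g y := g.contMDiff.mdifferentiableAt (by simp)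
  have hr' : MDifferentiableAt 𝓘(ℝ, E₃) 𝓘(ℝ, E₂) r (g y) :=
    (hr.contMDiffOn.contMDiffAt (hr.isOpen.mem_nhds (hr.apply_mem y))).mdifferentiableAt (by simp)
  have h := mfderiv_comp_apply y hr' hg v
  rw [hr.leftInverse.comp_eq_id, mfderiv_id] at h
  exact h.symm

theorem contMDiff_retractionDeriv [IsManifold 𝓘(ℝ, E₂) ∞ N₂] [IsManifold 𝓘(ℝ, E₃) ∞ N₃]
    (hr : IsNeighborhoodRetraction g r W) :
    ContMDiff (𝓘(ℝ, E₂).prod 𝓘(ℝ, E₃)) (𝓘(ℝ, E₂).prod 𝓘(ℝ, E₂)) ∞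
      (fun p : TotalSpace E₃ ((g : N₂ → N₃) *ᵖ (TangentSpace 𝓘(ℝ, E₃) : N₃ → Type _)) =>
        (⟨p.proj, retractionDeriv g r p.proj p.snd⟩ : TangentBundle 𝓘(ℝ, E₂) N₂)) := by
  have hdr := (hr.contMDiffOn.contMDiffOn_tangentMapWithin (m := ∞) (by simp)
    hr.isOpen.uniqueMDiffOn).comp_contMDiff (contMDiff_pullbackLift g) fun p => hr.apply_mem p.proj
  refine hdr.congr fun p => TotalSpace.ext (hr.leftInverse p.proj).symm (heq_of_eq ?_)
  have hp : mfderivWithin 𝓘(ℝ, E₃) 𝓘(ℝ, E₂) r W (g p.proj) =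
      mfderiv 𝓘(ℝ, E₃) 𝓘(ℝ, E₂) r (g p.proj) :=
    mfderivWithin_of_isOpen hr.isOpen (hr.apply_mem p.proj)
  exact congrArg (fun l => l p.snd) hp.symm

end IsNeighborhoodRetraction

end NeighborhoodRetraction

section NormalBundleComp

variable {E₁ : Type*} [NormedAddCommGroup E₁] [NormedSpace ℝ E₁]
  {N₁ : Type*} [TopologicalSpace N₁] [ChartedSpace E₁ N₁]
  {E₂ : Type u} [NormedAddCommGroup E₂] [NormedSpace ℝ E₂]
  {N₂ : Type*} [TopologicalSpace N₂] [ChartedSpace E₂ N₂]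
  {E₃ : Type u} [NormedAddCommGroup E₃] [NormedSpace ℝ E₃]
  {N₃ : Type*} [TopologicalSpace N₃] [ChartedSpace E₃ N₃]
  {g : C^∞⟮𝓘(ℝ, E₂), N₂; 𝓘(ℝ, E₃), N₃⟯} {r : N₃ → N₂} {W : Set N₃}

theorem tangentialRange_comp (g : C^∞⟮𝓘(ℝ, E₂), N₂; 𝓘(ℝ, E₃), N₃⟯)
    (f : C^∞⟮𝓘(ℝ, E₁), N₁; 𝓘(ℝ, E₂), N₂⟯) (x : N₁) :
    tangentialRange (g.comp f) x =
      (tangentialRange f x).map (mfderiv 𝓘(ℝ, E₂) 𝓘(ℝ, E₃) g (f x)).toLinearMap := by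
  have hf : MDifferentiableAt 𝓘(ℝ, E₁) 𝓘(ℝ, E₂) f x := f.contMDiff.mdifferentiableAt (by simp)
  have hg : MDifferentiableAt 𝓘(ℝ, E₂) 𝓘(ℝ, E₃) g (f x) := g.contMDiff.mdifferentiableAt (by simp)
  have hgf : mfderiv 𝓘(ℝ, E₁) 𝓘(ℝ, E₃) (g.comp f) x =
      (mfderiv 𝓘(ℝ, E₂) 𝓘(ℝ, E₃) g (f x)).comp (mfderiv 𝓘(ℝ, E₁) 𝓘(ℝ, E₂) f x) :=
    mfderiv_comp x hg hf
  rw [tangentialRange, hgf]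
  exact LinearMap.range_comp _ _

/-- The splitting `ν(g ∘ f)_x ≃ ν(f)_x × ν(g)_{f x}` induced by a smooth left inverse of `g` on a
neighborhood of its image. -/
noncomputable def IsNeighborhoodRetraction.normalFibreCompEquiv
    (hr : IsNeighborhoodRetraction g r W) (f : C^∞⟮𝓘(ℝ, E₁), N₁; 𝓘(ℝ, E₂), N₂⟯) (x : N₁) :
    NormalFibre (g.comp f) x ≃L[ℝ] NormalFibre f x × NormalFibre g (f x) :=
  quotientMapEquivProd (tangentialRange f x) (mfderiv 𝓘(ℝ, E₂) 𝓘(ℝ, E₃) g (f x))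
    (hr.leftInverse_retractionDeriv (f x)) (tangentialRange_comp g f x).symm

theorem HasTrivialNormalBundle.comp [IsManifold 𝓘(ℝ, E₂) ∞ N₂] [IsManifold 𝓘(ℝ, E₃) ∞ N₃]
    {f : C^∞⟮𝓘(ℝ, E₁), N₁; 𝓘(ℝ, E₂), N₂⟯}
    (hg : HasTrivialNormalBundle g) (hf : HasTrivialNormalBundle f)
    (hr : IsNeighborhoodRetraction g r W) : HasTrivialNormalBundle (g.comp f) := by
  obtain ⟨F, _, _, _, τ, hτ⟩ := hf
  obtain ⟨F', _, _, _, τ', hτ'⟩ := hg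
  have h_ambient := contMDiff_pullbackCompLift (F := E₃)
    (A := (TangentSpace 𝓘(ℝ, E₃) : N₃ → Type u)) g f
  have h_tangent := (contMDiff_pullback_iff f
    (A := (TangentSpace 𝓘(ℝ, E₂) : N₂ → Type u))
    (G := fun q : TotalSpace E₃ ((g.comp f : N₁ → N₃) *ᵖ (TangentSpace 𝓘(ℝ, E₃) : N₃ → Type u)) =>
      ⟨q.proj, retractionDeriv g r (f q.proj) q.snd⟩)).2
    ⟨contMDiff_proj _, hr.contMDiff_retractionDeriv.comp h_ambient⟩
  exact ⟨F × F', inferInstance, inferInstance, inferInstance,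
    fun x => (hr.normalFibreCompEquiv f x).trans ((τ x).prodCongr (τ' (f x))),
    (hτ.comp h_tangent).prodMk_space (hτ'.comp h_ambient)⟩

end NormalBundleComp

namespace InductiveLimit

variable {M : Type v} [TopologicalSpace M] {A : ℕ → Set M}

theorem continuous_dom_iff {Y : Type*} [TopologicalSpace Y] {h : InductiveLimit A → Y} :
    Continuous h ↔ ∀ n, Continuous (h ∘ ofMem A n) :=
  continuous_iSup_dom.trans (forall_congr' fun _ => continuous_coinduced_dom)

theorem continuous_ofMem (A : ℕ → Set M) (n : ℕ) : Continuous (ofMem A n) :=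
  continuous_dom_iff.1 continuous_id n

/-- Reindexing an increasing sequence along `φ → ∞` does not change its inductive limit. -/
def reindexHomeomorph (hA : Monotone A) {φ : ℕ → ℕ} (hφ : Tendsto φ atTop atTop) :
    InductiveLimit (fun k => A (φ k)) ≃ₜ InductiveLimit A where
  toFun x := ⟨x.1, x.2.elim fun k hk => ⟨φ k, hk⟩⟩
  invFun x := ⟨x.1, x.2.elim fun n hn =>
    (hφ.eventually_ge_atTop n).exists.imp fun _ hk => hA hk hn⟩
  left_inv _ := rfl
  right_inv _ := rfl
  continuous_toFun := continuous_dom_iff.2 fun k => continuous_ofMem A (φ k)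
  continuous_invFun := continuous_dom_iff.2 fun n => by
    obtain ⟨k, hk⟩ := (hφ.eventually_ge_atTop n).exists
    exact (continuous_ofMem (fun k => A (φ k)) k).comp (continuous_inclusion (hA hk))

end InductiveLimit

theorem IsFlag.subsequence {E : Type*} [NormedAddCommGroup E] [NormedSpace ℝ E] {δ : ℕ → ℕ}
    {A : ℕ → Submodule ℝ E} (hA : IsFlag δ A) {φ : ℕ → ℕ} (hφ : StrictMono φ) :
    IsFlag (fun k => δ (φ k)) (fun k => A (φ k)) where
  strictMono := hA.strictMono.comp hφ
  isClosed k := hA.isClosed _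
  finiteDimensional k := hA.finiteDimensional _
  finrank_eq k := hA.finrank_eq _
  le_succ k := monotone_nat_of_le_succ hA.le_succ (hφ.monotone k.le_succ)
  dense := by
    have hmono : Monotone fun n => (A n : Set E) := monotone_nat_of_le_succ hA.le_succ
    exact (congrArg Dense (hmono.iUnion_comp_tendsto_atTop hφ.tendsto_atTop)).mpr hA.dense
  exists_complements := by
    obtain ⟨C, hAC, hC⟩ := hA.exists_complements
    exact ⟨fun k => C (φ k), fun k => hAC _,
      fun k => antitone_nat_of_succ_le hC (hφ.monotone k.le_succ)⟩

section Filtration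

open ClosedSubmanifold (inclOfSubset)

variable {E : Type u} [NormedAddCommGroup E] [NormedSpace ℝ E]
  {M : Type v} [TopologicalSpace M] [ChartedSpace E M]

theorem IsTubularNeighborhood.exists_isNeighborhoodRetraction {S : ClosedSubmanifold E M}
    {V : Set M} (hV : IsTubularNeighborhood S V) :
    ∃ r : M → S.carrier, IsNeighborhoodRetraction S.incl r V := by
  obtain ⟨F, _, _, _, B, _, _, _, _, _, _, _, Φ, rfl, -, hΦ, hzero⟩ := hV
  refine ⟨fun y => (Φ.symm y).proj,
    { isOpen := Φ.open_target
      contMDiffOn := (contMDiff_proj B).comp_contMDiffOn hΦ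
      apply_mem := fun x => ?_
      leftInverse := fun x => ?_ }⟩
  · change (x : M) ∈ Φ.target
    exact (hzero x).2 ▸ Φ.map_source (hzero x).1
  · change (Φ.symm x).proj = x
    rw [← (hzero x).2, Φ.left_inv (hzero x).1]

theorem IsNeighborhoodRetraction.restrict {S T : ClosedSubmanifold E M} {r : M → S.carrier}
    {W : Set M} (hr : IsNeighborhoodRetraction S.incl r W) (hST : S.carrier ⊆ T.carrier) :
    IsNeighborhoodRetraction (inclOfSubset hST) (fun y : T.carrier => r y)
      (Subtype.val ⁻¹' W) where
  isOpen := hr.isOpen.preimage continuous_subtype_val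
  contMDiffOn := hr.contMDiffOn.comp T.incl.contMDiff.contMDiffOn Subset.rfl
  apply_mem := hr.apply_mem
  leftInverse := hr.leftInverse

theorem ClosedSubmanifold.inclOfSubset_comp_inclOfSubset {S T U : ClosedSubmanifold E M}
    (hST : S.carrier ⊆ T.carrier) (hTU : T.carrier ⊆ U.carrier) :
    (inclOfSubset hTU).comp (inclOfSubset hST) = inclOfSubset (hST.trans hTU) :=
  ContMDiffMap.ext fun _ => rfl

theorem IsTubularNeighborhood.hasTrivialNormalBundle_trans {S T U : ClosedSubmanifold E M}
    {V : Set M} (hV : IsTubularNeighborhood T V) {hST : S.carrier ⊆ T.carrier}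
    {hTU : T.carrier ⊆ U.carrier} (h₁ : HasTrivialNormalBundle (inclOfSubset hST))
    (h₂ : HasTrivialNormalBundle (inclOfSubset hTU)) :
    HasTrivialNormalBundle (inclOfSubset (hST.trans hTU)) := by
  obtain ⟨r, hr⟩ := hV.exists_isNeighborhoodRetraction
  rw [← ClosedSubmanifold.inclOfSubset_comp_inclOfSubset hST hTU]
  exact h₂.comp h₁ (hr.restrict hTU)

variable {δ : ℕ → ℕ} {ℱ : ℕ → ClosedSubmanifold E M} {φ : ℕ → ℕ}

theorem IsDeltaFiltration.monotone (hℱ : IsDeltaFiltration δ ℱ) :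
    Monotone fun n => (ℱ n).carrier :=
  monotone_nat_of_le_succ hℱ.subset_succ

theorem IsDeltaFiltration.subsequence (hℱ : IsDeltaFiltration δ ℱ) (hφ : StrictMono φ) :
    IsDeltaFiltration (fun k => δ (φ k)) (fun k => ℱ (φ k)) where
  strictMono := hℱ.strictMono.comp hφ
  nonempty k := hℱ.nonempty _
  dim_eq k := hℱ.dim_eq _
  subset_succ k := hℱ.monotone (hφ.monotone k.le_succ)
  isHomotopyEquivalence := by
    obtain ⟨e, he⟩ := hℱ.isHomotopyEquivalence
    let ι := InductiveLimit.reindexHomeomorph hℱ.monotone hφ.tendsto_atTop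
    exact ⟨ι.toHomotopyEquiv.trans e, funext fun x => congrFun he (ι x)⟩

theorem IsDenseFiltration.reindex (hdense : IsDenseFiltration ℱ)
    (hℱ : Monotone fun n => (ℱ n).carrier) (hφ : Tendsto φ atTop atTop) :
    IsDenseFiltration fun k => ℱ (φ k) :=
  (congrArg Dense (hℱ.iUnion_comp_tendsto_atTop hφ)).mpr hdense

theorem IsFredholmFiltration.subsequence (hℱ : IsFredholmFiltration δ ℱ) (hφ : StrictMono φ) :
    IsFredholmFiltration (fun k => δ (φ k)) (fun k => ℱ (φ k)) := by
  obtain ⟨E', _, _, _, f, A, hf, hA, hfA⟩ := hℱ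
  exact ⟨E', _, _, ‹_›, f, fun k => A (φ k), hf, hA.subsequence hφ, fun k => hfA _⟩

variable [IsManifold 𝓘(ℝ, E) ∞ M]

theorem IsNormalFiltration.hasTrivialNormalBundle (hℱ : IsNormalFiltration δ ℱ) {m n : ℕ}
    (hmn : m < n) : HasTrivialNormalBundle (inclOfSubset (hℱ.monotone hmn.le)) := by
  obtain ⟨V, -, hV, -⟩ := hℱ.exists_tubular
  induction n, hmn using Nat.le_induction with
  | base => exact hℱ.trivial_succ m
  | succ n _ ih => exact (hV n).hasTrivialNormalBundle_trans ih (hℱ.trivial_succ n)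

theorem IsNormalFiltration.subsequence (hℱ : IsNormalFiltration δ ℱ) (hφ : StrictMono φ) :
    IsNormalFiltration (fun k => δ (φ k)) (fun k => ℱ (φ k)) where
  toIsDeltaFiltration := hℱ.toIsDeltaFiltration.subsequence hφ
  trivial_succ k := hℱ.hasTrivialNormalBundle (hφ k.lt_succ_self)
  trivial_ambient k := hℱ.trivial_ambient _
  exists_tubular := by
    obtain ⟨V, U, hV, hUo, hUV, hU, hUM⟩ := hℱ.exists_tubular
    have hmono : Monotone U := monotone_nat_of_le_succ hU
    exact ⟨fun k => V (φ k), fun k => U (φ k), fun k => hV _, fun k => hUo _, fun k => hUV _,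
      fun k => hmono (hφ.monotone k.le_succ),
      (hmono.iUnion_comp_tendsto_atTop hφ.tendsto_atTop).trans hUM⟩

end Filtration

theorem mainTheorem12_general
    {E : Type u} [NormedAddCommGroup E] [NormedSpace ℝ E]
    {M : Type v} [TopologicalSpace M] [ChartedSpace E M] [IsManifold 𝓘(ℝ, E) ∞ M]
    (δ : ℕ → ℕ) (ℱ : ℕ → ClosedSubmanifold E M) (hℱ : IsNormalFiltration δ ℱ)
    (φ : ℕ → ℕ) (hφ : StrictMono φ) :
    IsNormalFiltration (fun k => δ (φ k)) (fun k => ℱ (φ k)) ∧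
    (IsDenseFiltration ℱ → IsDenseFiltration (fun k => ℱ (φ k))) ∧
    (IsFredholmFiltration δ ℱ →
      IsFredholmFiltration (fun k => δ (φ k)) (fun k => ℱ (φ k))) :=
  ⟨hℱ.subsequence hφ, fun h => h.reindex hℱ.monotone hφ.tendsto_atTop,
    fun h => h.subsequence hφ⟩

theorem mainTheorem12
    {E : Type u} [NormedAddCommGroup E] [NormedSpace ℝ E] [CompleteSpace E]
    [TopologicalSpace.SeparableSpace E]
    {M : Type v} [TopologicalSpace M] [ChartedSpace E M] [IsManifold 𝓘(ℝ, E) ∞ M]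
    [TopologicalSpace.SeparableSpace M] [TopologicalSpace.MetrizableSpace M] [ConnectedSpace M]
    (δ : ℕ → ℕ) (ℱ : ℕ → ClosedSubmanifold E M) (hℱ : IsNormalFiltration δ ℱ)
    (φ : ℕ → ℕ) (hφ : StrictMono φ) :
    IsNormalFiltration (fun k => δ (φ k)) (fun k => ℱ (φ k)) ∧
    (IsDenseFiltration ℱ → IsDenseFiltration (fun k => ℱ (φ k))) ∧
    (IsFredholmFiltration δ ℱ →
      IsFredholmFiltration (fun k => δ (φ k)) (fun k => ℱ (φ k))) :=
  mainTheorem12_general δ ℱ hℱ φ hφ
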